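/- Let $X$ be a real Banach space with $\dim X\ge 2$. For $x\in X\setminus\{0\}$ and $y\in X$, say that $y$ is quasi-orthogonal to $x$, written $y\urcorner x$, if there is a functional $p\in X^*$ with $\|p\|=1$, $\langle p,x\rangle=\|x\|$ and $\langle p,y\rangle=0$ (equivalently, $x$ is Birkhoff--James orthogonal to $y$). For $\varepsilon>0$ put $$\zeta_X^-(\varepsilon)=\inf\{\|x+\varepsilon y\| : x,y\in X,\ \|x\|=\|y\|=1,\ y\urcorner x\},\qquad \zeta_X^+(\varepsilon)=\sup\{\|x+\varepsilon y\| : x,y\in X,\ \|x\|=\|y\|=1,\ y\urcorner x\}.$$ **Theorem.** For every real Banach space $X$ with $\dim X\ge 2$, every real Hilbert space $H$ with $\dim H\ge 2$, and every $\varepsilon>0$, $$\zeta_X^-(\varepsilon)\le \zeta_H^-(\varepsilon)=\sqrt{1+\varepsilon^2}=\zeta_H^+(\varepsilon)\le \zeta_X^+(\varepsilon).$$ -/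

import Mathlib

/-- The duality map `J₁(x)`: the functionals of norm one that attain `‖x‖` at `x`. -/
def dualityMap {X : Type*} [NormedAddCommGroup X] [NormedSpace ℝ X] (x : X) : Set (StrongDual ℝ X) :=
  {p | ‖p‖ = 1 ∧ p x = ‖x‖}

/-- `QuasiOrthogonal y x`: the vector `y` is quasi-orthogonal to the nonzero vector `x`. -/
def QuasiOrthogonal {X : Type*} [NormedAddCommGroup X] [NormedSpace ℝ X] (y x : X) : Prop :=
  x ≠ 0 ∧ ∃ p ∈ dualityMap x, p y = 0

/-- The lengths `‖x + ε y‖` of the hypotenuses of the right-angled triangles whose catheti are the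
unit vector `x` and `ε` times a unit vector `y` that is quasi-orthogonal to `x`. -/
def hypotenuseLengths (X : Type*) [NormedAddCommGroup X] [NormedSpace ℝ X] (ε : ℝ) : Set ℝ :=
  {r | ∃ x y : X, ‖x‖ = 1 ∧ ‖y‖ = 1 ∧ QuasiOrthogonal y x ∧ r = ‖x + ε • y‖}

/-- The modulus `ζ⁻_X(ε)`. -/
noncomputable def zetaMinus (X : Type*) [NormedAddCommGroup X] [NormedSpace ℝ X] (ε : ℝ) : ℝ :=
  sInf (hypotenuseLengths X ε)

/-- The modulus `ζ⁺_X(ε)`. -/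
noncomputable def zetaPlus (X : Type*) [NormedAddCommGroup X] [NormedSpace ℝ X] (ε : ℝ) : ℝ :=
  sSup (hypotenuseLengths X ε)

/-- The infimum and the supremum above are taken over a bounded set. -/
theorem hypotenuseLengths_subset (X : Type*) [NormedAddCommGroup X] [NormedSpace ℝ X] (ε : ℝ) :
    hypotenuseLengths X ε ⊆ Set.Icc 0 (1 + |ε|) := by
  rintro r ⟨x, y, hx, hy, -, rfl⟩
  refine ⟨norm_nonneg _, (norm_add_le _ _).trans ?_⟩
  rw [norm_smul, hx, hy, Real.norm_eq_abs, mul_one]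

/-- In dimension at least two, they are taken over a nonempty set. -/
theorem hypotenuseLengths_nonempty (X : Type*) [NormedAddCommGroup X] [NormedSpace ℝ X]
    (hX : 2 ≤ Module.rank ℝ X) (ε : ℝ) : (hypotenuseLengths X ε).Nonempty := by
  have h1 : 1 < Module.rank ℝ X := lt_of_lt_of_le (by norm_num) hX
  have : Nontrivial X := rank_pos_iff_nontrivial.1 (lt_trans (by norm_num) h1)
  obtain ⟨x, hx⟩ := exists_norm_eq X (zero_le_one (α := ℝ))
  have hx0 : x ≠ 0 := by
    rintro rfl
    simp at hx
  obtain ⟨p, hp, hpx⟩ := exists_dual_vector ℝ x (by simpa using hx0)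
  obtain ⟨v, hv⟩ := exists_linearIndependent_pair_of_one_lt_rank h1 hx0
  have hpx1 : p x = 1 := by simpa [hx] using hpx
  set w : X := v - p v • x with hw
  have hw0 : w ≠ 0 := by
    intro h
    have := (LinearIndependent.pair_iff.1 hv) (-(p v)) 1 (by rw [← h, hw]; module)
    exact one_ne_zero this.2
  have hpw : p w = 0 := by simp [hw, hpx1]
  refine ⟨_, x, ‖w‖⁻¹ • w, hx, ?_, ⟨hx0, p, ⟨hp, by simpa using hpx⟩, by simp [hpw]⟩, rfl⟩
  rw [norm_smul, norm_inv, norm_norm, inv_mul_cancel₀ (norm_ne_zero_iff.2 hw0)]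

/-! Restrict the norm to a plane in `X`, with unit ball `B` of area `A`. If the line through a unit
vector `x` with direction `y` supports `B`, then `y` is quasi-orthogonal to `x`. Orient all
supporting lines alike and attach to each tangency point the forward segment of length `ε`. By
Mamikon's argument the swept area is that obtained by translating all segments to the origin, namely
`ε² A` (`volume_sweptRegion_union_neg`).

For this, write the line of slope `m` as `b = m a - k m`, where `k` is the support function. It
touches `B` at `a = k' m`, and the Jacobian of `(m, a) ↦ (a, b)` is `a - k' m` in absolute value, so
the area depends only on the lengths. Since `k` is Lipschitz, it is differentiable almost
everywhere.

The norm does not decrease along a tangent half-line, so the endpoints control it. If they all lie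
outside `rB`, then `B` and the swept region cover `rB` up to a null set, whence `r² ≤ 1 + ε²`
(`volume_ball_le`). If they all lie in `RB`, then so does the swept region, which avoids the
interior of `B`, whence `1 + ε² ≤ R²` (`le_volume_ball`). In `H` Pythagoras gives equality. -/

open MeasureTheory Set
open scoped ENNReal NNReal Pointwise

/-! ### Area swept by segments along a family of lines -/

/-- The point with first coordinate `q.2` on the line of slope `q.1` and intercept `-k q.1`. -/
def tangentPoint (k : ℝ → ℝ) (q : ℝ × ℝ) : ℝ × ℝ := (q.2, q.1 * q.2 - k q.1)

/-- The parameters of the points lying to the right of the point of tangency at horizontal distance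
at most `L`. -/
def tangentRegion (k L : ℝ → ℝ) : Set (ℝ × ℝ) :=
  {q | DifferentiableAt ℝ k q.1 ∧ q.2 - deriv k q.1 ∈ Ioc 0 (L q.1)}

/-- The derivative of `tangentPoint k` at `q`. -/
noncomputable def fderivTangentPoint (k : ℝ → ℝ) (q : ℝ × ℝ) : ℝ × ℝ →L[ℝ] ℝ × ℝ :=
  (Matrix.toLin (.finTwoProd ℝ) (.finTwoProd ℝ)
    !![0, 1; q.2 - deriv k q.1, q.1]).toContinuousLinearMap

theorem hasFDerivAt_tangentPoint {k : ℝ → ℝ} {q : ℝ × ℝ} (hq : DifferentiableAt ℝ k q.1) :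
    HasFDerivAt (tangentPoint k) (fderivTangentPoint k q) q := by
  unfold fderivTangentPoint
  rw [Matrix.toLin_finTwoProd_toContinuousLinearMap]
  have := HasFDerivAt.prodMk (𝕜 := ℝ) (hasFDerivAt_snd (p := q))
    ((hasFDerivAt_fst.mul hasFDerivAt_snd).sub
      (hq.hasDerivAt.comp_hasFDerivAt q hasFDerivAt_fst))
  refine this.congr_fderiv ?_
  ext <;> simp

theorem det_fderivTangentPoint (k : ℝ → ℝ) (q : ℝ × ℝ) :
    (fderivTangentPoint k q).det = -(q.2 - deriv k q.1) := by
  simp [fderivTangentPoint, LinearMap.det_toContinuousLinearMap, LinearMap.det_toLin,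
    Matrix.det_fin_two_of]

theorem measurableSet_tangentRegion {k L : ℝ → ℝ} (hL : Measurable L) :
    MeasurableSet (tangentRegion k L) := by
  have h1 : MeasurableSet {m | DifferentiableAt ℝ k m} := measurableSet_of_differentiableAt ℝ k
  have h2 : Measurable fun q : ℝ × ℝ => q.2 - deriv k q.1 :=
    measurable_snd.sub ((measurable_deriv k).comp measurable_fst)
  exact (measurable_fst h1).inter
    ((measurableSet_lt measurable_const h2).inter
      (measurableSet_le h2 (hL.comp measurable_fst)))

theorem measurableSet_image_tangentPoint {k L : ℝ → ℝ} (hL : Measurable L)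
    (hinj : InjOn (tangentPoint k) (tangentRegion k L)) :
    MeasurableSet (tangentPoint k '' tangentRegion k L) :=
  measurable_image_of_fderivWithin (measurableSet_tangentRegion hL)
    (fun _ hq => (hasFDerivAt_tangentPoint hq.1).hasFDerivWithinAt) hinj

/-- The area swept by the tangent segments does not depend on the curve. -/
theorem volume_image_tangentPoint {k L : ℝ → ℝ} (hL : Measurable L)
    (hk : ∀ᵐ m, DifferentiableAt ℝ k m)
    (hinj : InjOn (tangentPoint k) (tangentRegion k L)) :
    volume (tangentPoint k '' tangentRegion k L) =
      ∫⁻ m, ∫⁻ t, (Ioc 0 (L m)).indicator ENNReal.ofReal t := by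
  have hmeas := measurableSet_tangentRegion (k := k) hL
  have h2 : Measurable fun q : ℝ × ℝ => q.2 - deriv k q.1 :=
    measurable_snd.sub ((measurable_deriv k).comp measurable_fst)
  rw [← lintegral_abs_det_fderiv_eq_addHaar_image volume hmeas
    (fun _ hq => (hasFDerivAt_tangentPoint hq.1).hasFDerivWithinAt) hinj]
  simp_rw [det_fderivTangentPoint, abs_neg]
  rw [← lintegral_indicator hmeas, Measure.volume_eq_prod, lintegral_prod]
  · refine lintegral_congr_ae ?_
    filter_upwards [hk] with m hm
    -- Translating by `k' m` moves the point of tangency to `0`; this removes `k` from the integral.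
    rw [← lintegral_sub_right_eq_self ((Ioc 0 (L m)).indicator ENNReal.ofReal) (deriv k m)]
    refine lintegral_congr fun a => ?_
    by_cases ha : a - deriv k m ∈ Ioc 0 (L m)
    · rw [indicator_of_mem ha, indicator_of_mem (show (m, a) ∈ tangentRegion k L from ⟨hm, ha⟩),
        abs_of_pos ha.1]
    · rw [indicator_of_notMem ha, indicator_of_notMem fun h => ha h.2]
  · exact ((ENNReal.measurable_ofReal.comp
      (continuous_abs.measurable.comp h2)).indicator hmeas).aemeasurable

/-- This discards the lines whose slope is a point of non-differentiability of `k`: on bounded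
squares `tangentPoint k` is Lipschitz, hence preserves null sets. -/
theorem volume_image_tangentPoint_null {k : ℝ → ℝ} {C : ℝ≥0} (hk : LipschitzWith C k)
    {N : Set ℝ} (hN : volume N = 0) : volume (tangentPoint k '' (N ×ˢ univ)) = 0 := by
  have hcover : tangentPoint k '' (N ×ˢ univ) ⊆
      ⋃ n : ℕ, tangentPoint k '' ((N ×ˢ univ) ∩ Icc (-(n : ℝ)) n ×ˢ Icc (-(n : ℝ)) n) := by
    rintro _ ⟨q, hq, rfl⟩
    obtain ⟨n, hn⟩ := exists_nat_ge (max |q.1| |q.2|)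
    exact mem_iUnion.2 ⟨n, q, ⟨hq, abs_le.1 ((le_max_left _ _).trans hn),
      abs_le.1 ((le_max_right _ _).trans hn)⟩, rfl⟩
  refine measure_mono_null hcover (measure_iUnion_null fun n => ?_)
  have hlip : LipschitzOnWith (1 + 2 * n + C) (tangentPoint k)
      ((N ×ˢ univ) ∩ Icc (-(n : ℝ)) n ×ˢ Icc (-(n : ℝ)) n) := by
    refine LipschitzOnWith.of_dist_le_mul fun p hp q hq => ?_
    have hp1 : |p.1| ≤ n := abs_le.2 hp.2.1
    have hq2 : |q.2| ≤ n := abs_le.2 hq.2.2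
    have h1 : |p.1 - q.1| ≤ dist p q := by
      rw [Prod.dist_eq, ← Real.dist_eq]; exact le_max_left _ _
    have h2 : |p.2 - q.2| ≤ dist p q := by
      rw [Prod.dist_eq, ← Real.dist_eq]; exact le_max_right _ _
    have h3 : |k p.1 - k q.1| ≤ C * |p.1 - q.1| := by
      simpa only [Real.dist_eq] using hk.dist_le_mul p.1 q.1
    have h4 : (C : ℝ) * |p.1 - q.1| ≤ C * dist p q := by gcongr
    have hd : 0 ≤ dist p q := dist_nonneg
    have hn : (0 : ℝ) ≤ n := Nat.cast_nonneg n
    have hC : (0 : ℝ) ≤ C := C.2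
    rw [Prod.dist_eq]
    push_cast
    refine max_le ?_ ?_
    · simp only [tangentPoint, Real.dist_eq]
      nlinarith [mul_nonneg hn hd, mul_nonneg hC hd]
    · simp only [tangentPoint, Real.dist_eq]
      have e : p.1 * p.2 - k p.1 - (q.1 * q.2 - k q.1) =
          p.1 * (p.2 - q.2) + (p.1 - q.1) * q.2 - (k p.1 - k q.1) := by ring
      rw [e]
      have h5 : |p.1 * (p.2 - q.2)| ≤ n * dist p q := by rw [abs_mul]; gcongr
      have h6 : |(p.1 - q.1) * q.2| ≤ dist p q * n := by rw [abs_mul]; gcongr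
      have h7 := abs_sub (p.1 * (p.2 - q.2) + (p.1 - q.1) * q.2) (k p.1 - k q.1)
      have h8 := abs_add_le (p.1 * (p.2 - q.2)) ((p.1 - q.1) * q.2)
      nlinarith
  have h0 : volume ((N ×ˢ univ) ∩ Icc (-(n : ℝ)) n ×ˢ Icc (-(n : ℝ)) n) = 0 := by
    refine measure_mono_null inter_subset_left ?_
    rw [Measure.volume_eq_prod, Measure.prod_prod, hN, zero_mul]
  -- In the plane, two-dimensional Hausdorff measure is `volume`.
  have h := hlip.hausdorffMeasure_image_le (d := 2) (by norm_num)
  rw [hausdorffMeasure_prod_real, h0, mul_zero] at h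
  exact le_antisymm h zero_le

/-! ### Quasi-orthogonality and the Hilbert space case -/

/-- A vector `y` such that `x` is Birkhoff orthogonal to `y` is quasi-orthogonal to `x`. -/
theorem quasiOrthogonal_of_norm_le {X : Type*} [NormedAddCommGroup X] [NormedSpace ℝ X] {x y : X}
    (hx : x ≠ 0) (h : ∀ t : ℝ, ‖x‖ ≤ ‖x + t • y‖) : QuasiOrthogonal y x := by
  let S : Submodule ℝ X := Submodule.span ℝ {y}
  -- The hypothesis says that `x` has distance `‖x‖` from the line `S`, so a norming functional on
  -- `X ⧸ S` pulls back to the required one.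
  have hnorm : ‖(S.mkQ x)‖ = ‖x‖ := by
    refine le_antisymm (Submodule.Quotient.norm_mk_le S x) ?_
    refine le_of_forall_pos_lt_add fun δ hδ => ?_
    obtain ⟨m, hm, hlt⟩ := Submodule.Quotient.norm_mk_lt (S.mkQ x) hδ
    obtain ⟨t, ht⟩ := Submodule.mem_span_singleton.1 ((Submodule.Quotient.eq S).1 hm)
    refine lt_of_le_of_lt (h t) ?_
    rwa [ht, add_sub_cancel]
  obtain ⟨g, hg, hgx⟩ := exists_dual_vector ℝ (S.mkQ x) (by rw [hnorm]; simpa using hx)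
  let π : X →L[ℝ] X ⧸ S := S.mkQ.mkContinuous 1 fun z => by
    rw [one_mul]; exact Submodule.Quotient.norm_mk_le S z
  have hpx : (g.comp π) x = ‖x‖ := by
    rw [← hnorm]; exact hgx
  refine ⟨hx, g.comp π, ⟨le_antisymm ?_ ?_, hpx⟩, ?_⟩
  · refine (g.opNorm_comp_le π).trans ?_
    rw [hg, one_mul]
    exact S.mkQ.mkContinuous_norm_le zero_le_one _
  · have := (g.comp π).le_opNorm x
    rw [hpx, norm_norm] at this
    exact le_of_mul_le_mul_right (by simpa using this) (norm_pos_iff.2 hx)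
  · have : S.mkQ y = 0 := by
      exact (Submodule.Quotient.mk_eq_zero S).2 (Submodule.mem_span_singleton_self y)
    change g (S.mkQ y) = 0
    rw [this, map_zero]

/-- The Riesz vector of `p` is a unit vector with inner product `1` with `x`, so it equals `x`. -/
theorem QuasiOrthogonal.inner_eq_zero {H : Type*} [NormedAddCommGroup H] [InnerProductSpace ℝ H]
    [CompleteSpace H] {x y : H} (hx : ‖x‖ = 1) (h : QuasiOrthogonal y x) : inner ℝ x y = 0 := by
  obtain ⟨-, p, ⟨hp, hpx⟩, hpy⟩ := h
  set z := (InnerProductSpace.toDual ℝ H).symm p with hz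
  have hzn : ‖z‖ = 1 := by rw [hz, LinearIsometryEquiv.norm_map, hp]
  have hzi : ∀ w, inner ℝ z w = p w := fun w => by
    rw [hz, InnerProductSpace.toDual_symm_apply]
  have : z = x := by
    rw [← inner_eq_one_iff_of_norm_eq_one (𝕜 := ℝ) hzn hx, hzi, hpx, hx]
  rw [← this, hzi, hpy]

theorem hypotenuseLengths_hilbert {H : Type*} [NormedAddCommGroup H] [InnerProductSpace ℝ H]
    [CompleteSpace H] (hH : 2 ≤ Module.rank ℝ H) (ε : ℝ) :
    hypotenuseLengths H ε = {Real.sqrt (1 + ε ^ 2)} := by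
  refine (hypotenuseLengths_nonempty H hH ε).subset_singleton_iff.1 ?_
  rintro r ⟨x, y, hx, hy, hxy, rfl⟩
  rw [mem_singleton_iff, eq_comm, Real.sqrt_eq_iff_mul_self_eq (by positivity) (norm_nonneg _),
    norm_add_mul_self_real, inner_smul_right, hxy.inner_eq_zero hx, norm_smul, hx, hy,
    Real.norm_eq_abs]
  nlinarith [sq_abs ε]

/-! ### Supporting lines of the unit ball of a plane -/

/-- The standard area form of the plane. -/
def wedge (p q : ℝ × ℝ) : ℝ := p.1 * q.2 - p.2 * q.1

theorem exists_smul_eq_of_wedge_eq_zero {q u : ℝ × ℝ} (hu : u ≠ 0) (h : wedge q u = 0) :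
    ∃ t : ℝ, q = t • u := by
  unfold wedge at h
  by_cases h1 : u.1 = 0
  · have h2 : u.2 ≠ 0 := fun h2 => hu (Prod.ext h1 h2)
    refine ⟨q.2 / u.2, Prod.ext ?_ ?_⟩
    · have : q.1 * u.2 = 0 := by rw [h1] at h; linarith
      simp [h1, (mul_eq_zero.1 this).resolve_right h2]
    · simp [h2]
  · refine ⟨q.1 / u.1, Prod.ext ?_ ?_⟩
    · simp [h1]
    · simp only [Prod.smul_snd, smul_eq_mul]
      field_simp
      linarith

section Tangent

variable {X : Type*} [NormedAddCommGroup X] [NormedSpace ℝ X] {e : ℝ × ℝ →L[ℝ] X}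

/-- The vector `x` of the unit ball of the norm `‖e ·‖` lies on the supporting line of this ball
with direction `u`. -/
def IsTangent (e : ℝ × ℝ →L[ℝ] X) (x u : ℝ × ℝ) : Prop :=
  ‖e x‖ ≤ 1 ∧ ∀ z, ‖e z‖ ≤ 1 → wedge z u ≤ wedge x u

theorem IsTangent.smul {x u : ℝ × ℝ} (h : IsTangent e x u) {c : ℝ} (hc : 0 ≤ c) :
    IsTangent e x (c • u) := by
  refine ⟨h.1, fun z hz => ?_⟩
  have := mul_le_mul_of_nonneg_left (h.2 z hz) hc
  simp only [wedge, Prod.smul_fst, Prod.smul_snd, smul_eq_mul] at this ⊢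
  linarith

theorem IsTangent.neg {x u : ℝ × ℝ} (h : IsTangent e x u) : IsTangent e (-x) (-u) := by
  refine ⟨by rw [map_neg, norm_neg]; exact h.1, fun z hz => ?_⟩
  have := h.2 (-z) (by rwa [map_neg, norm_neg])
  simp only [wedge, Prod.fst_neg, Prod.snd_neg] at this ⊢
  linarith

theorem IsTangent.wedge_pos {x u : ℝ × ℝ} (h : IsTangent e x u) (hu : u ≠ 0) :
    0 < wedge x u := by
  -- A quarter turn of `u`, with `wedge w u = |u|²`; a small multiple of it lies in the ball.
  set w : ℝ × ℝ := (u.2, -u.1) with hw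
  have hpos : 0 < wedge w u := by
    have : wedge w u = u.2 ^ 2 + u.1 ^ 2 := by simp only [wedge, hw]; ring
    rw [this]
    by_contra! h0
    exact hu (Prod.ext (by simp only [Prod.fst_zero]; nlinarith [sq_nonneg u.1, sq_nonneg u.2])
      (by simp only [Prod.snd_zero]; nlinarith [sq_nonneg u.1, sq_nonneg u.2]))
  have hc : 0 < (1 + ‖e w‖)⁻¹ := by positivity
  have := h.2 ((1 + ‖e w‖)⁻¹ • w) (by
    rw [map_smul, norm_smul, Real.norm_of_nonneg hc.le, inv_mul_le_one₀ (by positivity)]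
    linarith)
  refine lt_of_lt_of_le ?_ this
  have h2 : wedge ((1 + ‖e w‖)⁻¹ • w) u = (1 + ‖e w‖)⁻¹ * wedge w u := by
    simp only [wedge, Prod.smul_fst, Prod.smul_snd, smul_eq_mul]; ring
  rw [h2]
  positivity

theorem wedge_add_smul_self (x u : ℝ × ℝ) (t : ℝ) : wedge (x + t • u) u = wedge x u := by
  simp only [wedge, Prod.fst_add, Prod.snd_add, Prod.smul_fst, Prod.smul_snd, smul_eq_mul]
  ring

theorem IsTangent.one_le_norm {x u : ℝ × ℝ} (h : IsTangent e x u) (hu : u ≠ 0) (t : ℝ) :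
    1 ≤ ‖e (x + t • u)‖ := by
  by_contra! hlt
  set w := x + t • u with hw
  have h0 := norm_nonneg (e w)
  have hpos := h.wedge_pos hu
  -- If `‖e w‖ < 1`, this factor exceeds `1` yet keeps `w` in the ball, which contradicts
  -- maximality.
  have h1 := h.2 ((2 / (1 + ‖e w‖)) • w) (by
    rw [map_smul, norm_smul, Real.norm_of_nonneg (by positivity), div_mul_eq_mul_div,
      div_le_one (by positivity)]
    linarith)
  have h2 : wedge ((2 / (1 + ‖e w‖)) • w) u = 2 / (1 + ‖e w‖) * wedge w u := by
    simp only [wedge, Prod.smul_fst, Prod.smul_snd, smul_eq_mul]; ring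
  rw [h2, hw, wedge_add_smul_self, ← hw] at h1
  have h3 : 1 < 2 / (1 + ‖e w‖) := by rw [lt_div_iff₀ (by positivity)]; linarith
  nlinarith

theorem IsTangent.norm_eq_one {x u : ℝ × ℝ} (h : IsTangent e x u) (hu : u ≠ 0) : ‖e x‖ = 1 :=
  le_antisymm h.1 (by simpa using h.one_le_norm hu 0)

theorem IsTangent.norm_mono {x u : ℝ × ℝ} (h : IsTangent e x u) (hu : u ≠ 0) {s t : ℝ}
    (hs : 0 ≤ s) (hst : s ≤ t) : ‖e (x + s • u)‖ ≤ ‖e (x + t • u)‖ := by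
  rcases hs.eq_or_lt with rfl | hs
  · simpa [h.norm_eq_one hu] using h.one_le_norm hu t
  have ht : 0 < t := hs.trans_le hst
  have hl : s / t ≤ 1 := (div_le_one ht).2 hst
  have hl0 : 0 ≤ s / t := by positivity
  -- Convexity of the norm along the half-line, whose minimum is at `x`.
  have key : x + s • u = (1 - s / t) • x + (s / t) • (x + t • u) := by
    rw [smul_add, smul_smul, div_mul_cancel₀ _ ht.ne']
    module
  have hone := h.one_le_norm hu t
  calc ‖e (x + s • u)‖ ≤ ‖(1 - s / t) • e x‖ + ‖(s / t) • e (x + t • u)‖ := by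
        rw [key, map_add, map_smul, map_smul]; exact norm_add_le _ _
    _ = (1 - s / t) * 1 + s / t * ‖e (x + t • u)‖ := by
        rw [norm_smul, norm_smul, Real.norm_of_nonneg (sub_nonneg.2 hl), Real.norm_of_nonneg hl0,
          h.norm_eq_one hu]
    _ ≤ ‖e (x + t • u)‖ := by nlinarith

/-- Two tangent half-lines through the same point have the same direction. -/
theorem IsTangent.wedge_eq_zero {x x' u u' : ℝ × ℝ} (h : IsTangent e x u) (h' : IsTangent e x' u')
    {t t' : ℝ} (ht : 0 < t) (ht' : 0 < t') (heq : x + t • u = x' + t' • u') : wedge u u' = 0 := by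
  have h1 := h.2 x' h'.1
  have h2 := h'.2 x h.1
  have e1 := congrArg Prod.fst heq
  have e2 := congrArg Prod.snd heq
  simp only [Prod.fst_add, Prod.snd_add, Prod.smul_fst, Prod.smul_snd, smul_eq_mul] at e1 e2
  -- Maximality of `x` and of `x'` bounds `wedge u u'` from opposite sides.
  have k1 : wedge x u - wedge x' u = t' * -wedge u u' := by
    simp only [wedge]
    linear_combination u.2 * e1 - u.1 * e2
  have k2 : wedge x' u' - wedge x u' = t * wedge u u' := by
    simp only [wedge]
    linear_combination -u'.2 * e1 + u'.1 * e2
  have := nonneg_of_mul_nonneg_right (k1 ▸ sub_nonneg.2 h1) ht'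
  have := nonneg_of_mul_nonneg_right (k2 ▸ sub_nonneg.2 h2) ht
  linarith

theorem IsTangent.mem_hypotenuseLengths (he : Function.Injective e) {x u : ℝ × ℝ}
    (h : IsTangent e x u) (hu : u ≠ 0) (ε : ℝ) :
    ‖e (x + (ε / ‖e u‖) • u)‖ ∈ hypotenuseLengths X ε := by
  have hx := h.norm_eq_one hu
  have hu0 : ‖e u‖ ≠ 0 := by simpa [map_eq_zero_iff e he] using hu
  refine ⟨e x, ‖e u‖⁻¹ • e u, hx, ?_, quasiOrthogonal_of_norm_le ?_ fun t => ?_, ?_⟩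
  · rw [norm_smul, norm_inv, norm_norm, inv_mul_cancel₀ hu0]
  · rw [← norm_ne_zero_iff, hx]; exact one_ne_zero
  · rw [hx, smul_smul, ← map_smul, ← map_add]
    exact h.one_le_norm hu _
  · rw [smul_smul, map_add, map_smul, div_eq_mul_inv]

theorem isCompact_setOf_norm_le (he : Function.Injective e) (r : ℝ) :
    IsCompact {v | ‖e v‖ ≤ r} := by
  obtain ⟨K, -, hK⟩ := (e : ℝ × ℝ →ₗ[ℝ] X).exists_antilipschitzWith (LinearMap.ker_eq_bot.2 he)
  refine Metric.isCompact_of_isClosed_isBounded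
    (isClosed_le e.continuous.norm continuous_const) ?_
  refine (hK.isBounded_preimage (Metric.isBounded_closedBall (x := 0) (r := r))).subset ?_
  intro v hv
  simpa using hv

theorem continuous_wedge_left (u : ℝ × ℝ) : Continuous fun x => wedge x u := by
  unfold wedge
  fun_prop

theorem exists_isTangent (he : Function.Injective e) (u : ℝ × ℝ) : ∃ x, IsTangent e x u := by
  obtain ⟨x, hx, hmax⟩ := (isCompact_setOf_norm_le he 1).exists_isMaxOn ⟨0, by simp⟩
    (continuous_wedge_left u).continuousOn
  exact ⟨x, hx, fun z hz => hmax hz⟩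

/-- The support function of the unit ball of the norm `‖e ·‖`, with respect to the area form. -/
noncomputable def wedgeSupport (e : ℝ × ℝ →L[ℝ] X) (u : ℝ × ℝ) : ℝ :=
  sSup ((fun x => wedge x u) '' {x | ‖e x‖ ≤ 1})

theorem IsTangent.wedgeSupport_eq {x u : ℝ × ℝ} (h : IsTangent e x u) :
    wedgeSupport e u = wedge x u :=
  IsGreatest.csSup_eq ⟨⟨x, h.1, rfl⟩, by rintro _ ⟨z, hz, rfl⟩; exact h.2 z hz⟩

theorem wedge_le_wedgeSupport (he : Function.Injective e) {z : ℝ × ℝ} (hz : ‖e z‖ ≤ 1)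
    (u : ℝ × ℝ) : wedge z u ≤ wedgeSupport e u := by
  obtain ⟨x, hx⟩ := exists_isTangent he u
  rw [hx.wedgeSupport_eq]
  exact hx.2 z hz

theorem exists_lipschitzWith_wedgeSupport (he : Function.Injective e) :
    ∃ C : ℝ≥0, LipschitzWith C (wedgeSupport e) := by
  obtain ⟨C, hC0, hC⟩ := (isCompact_setOf_norm_le he 1).isBounded.exists_pos_norm_le
  refine ⟨⟨2 * C, by positivity⟩, LipschitzWith.of_le_add_mul _ fun u v => ?_⟩
  obtain ⟨x, hx⟩ := exists_isTangent he u
  have hxC := hC x hx.1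
  have hx1 : |x.1| ≤ C := (norm_fst_le x).trans hxC
  have hx2 : |x.2| ≤ C := (norm_snd_le x).trans hxC
  have h1 : |u.1 - v.1| ≤ dist u v := by rw [dist_eq_norm]; exact norm_fst_le (u - v)
  have h2 : |u.2 - v.2| ≤ dist u v := by rw [dist_eq_norm]; exact norm_snd_le (u - v)
  have h3 := wedge_le_wedgeSupport he hx.1 v
  have h4 : x.1 * (u.2 - v.2) ≤ C * dist u v :=
    (le_abs_self _).trans (by rw [abs_mul]; gcongr)
  have h5 : -(x.2 * (u.1 - v.1)) ≤ C * dist u v :=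
    (neg_le_abs _).trans (by rw [abs_mul]; gcongr)
  rw [hx.wedgeSupport_eq]
  change wedge x u ≤ wedgeSupport e v + 2 * C * dist u v
  simp only [wedge] at h3 ⊢
  linarith

/-- Every point outside the unit ball lies on a tangent half-line. -/
theorem exists_isTangent_add_smul_eq (he : Function.Injective e) {p : ℝ × ℝ} (hp : 1 < ‖e p‖) :
    ∃ (x u : ℝ × ℝ) (t : ℝ), u ≠ 0 ∧ IsTangent e x u ∧ 0 < t ∧ p = x + t • u := by
  obtain ⟨g, hg, hgp⟩ := exists_dual_vector ℝ (e p) (by linarith)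
  -- The direction of the level lines of a norming functional at `p`: the parallel to it through `p`
  -- misses the ball.
  set v : ℝ × ℝ := (-g (e (0, 1)), g (e (1, 0))) with hv
  have hgv : ∀ x, wedge x v = g (e x) := fun x => by
    have hx : x = x.1 • ((1, 0) : ℝ × ℝ) + x.2 • ((0, 1) : ℝ × ℝ) := by ext <;> simp
    conv_rhs => rw [hx]
    simp only [wedge, hv, map_add, map_smul, smul_eq_mul]
    ring
  have hball : ∀ x, ‖e x‖ ≤ 1 → wedge x v ≤ 1 := fun x hx => by
    rw [hgv]
    refine (le_abs_self _).trans ((g.le_opNorm _).trans ?_)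
    rwa [hg, one_mul]
  have hpv : 1 < wedge p v := by rw [hgv, hgp]; exact hp
  have hp0 : p ≠ 0 := by rintro rfl; simp at hp; linarith
  obtain ⟨C, hC⟩ := exists_lipschitzWith_wedgeSupport he
  -- A zero of `f` is a direction whose supporting line passes through `p`. Turning from `p` to `v`,
  -- the line through `p` goes from crossing the interior of the ball to missing the ball.
  set f : ℝ → ℝ := fun s => wedgeSupport e (p + s • (v - p)) - wedge p (p + s • (v - p)) with hf
  have hfc : Continuous f := by
    have := hC.continuous
    simp only [hf, wedge]
    fun_prop
  obtain ⟨x0, hx0⟩ := exists_isTangent he p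
  obtain ⟨x1, hx1⟩ := exists_isTangent he v
  have hf0 : 0 ≤ f 0 := by
    have : wedge p p = 0 := by simp only [wedge]; ring
    simp only [hf, zero_smul, add_zero, this, sub_zero, hx0.wedgeSupport_eq]
    exact (hx0.wedge_pos hp0).le
  have hf1 : f 1 < 0 := by
    simp only [hf, one_smul, add_sub_cancel, hx1.wedgeSupport_eq]
    linarith [hball x1 hx1.1]
  obtain ⟨s, hs, hfs⟩ := intermediate_value_Icc' zero_le_one hfc.continuousOn
    (show (0 : ℝ) ∈ Icc (f 1) (f 0) from ⟨hf1.le, hf0⟩)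
  have hs1 : s < 1 := lt_of_le_of_ne hs.2 fun h => by rw [h] at hfs; linarith
  set u := p + s • (v - p) with hu
  have huv : wedge u v = (1 - s) * wedge p v := by
    simp only [wedge, hu, Prod.fst_add, Prod.snd_add, Prod.smul_fst, Prod.smul_snd, smul_eq_mul,
      Prod.fst_sub, Prod.snd_sub]
    ring
  have huv0 : 0 < wedge u v := by rw [huv]; exact mul_pos (by linarith) (by linarith)
  have hu0 : u ≠ 0 := by
    rintro h
    rw [h] at huv0
    simp [wedge] at huv0
  obtain ⟨x, hx⟩ := exists_isTangent he u
  have hw : wedge (p - x) u = 0 := by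
    have h1 : wedgeSupport e u - wedge p u = 0 := hfs
    rw [hx.wedgeSupport_eq] at h1
    simp only [wedge, Prod.fst_sub, Prod.snd_sub] at h1 ⊢
    linarith
  obtain ⟨t, ht⟩ := exists_smul_eq_of_wedge_eq_zero hu0 hw
  have hpx : p = x + t • u := by rw [← ht, add_sub_cancel]
  refine ⟨x, u, t, hu0, hx, ?_, hpx⟩
  -- As `wedge x v ≤ 1 < wedge p v` and `wedge u v > 0`, the point `p` lies ahead of `x`.
  have h2 : wedge p v = wedge x v + t * wedge u v := by
    have e1 := congrArg Prod.fst hpx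
    have e2 := congrArg Prod.snd hpx
    simp only [Prod.fst_add, Prod.snd_add, Prod.smul_fst, Prod.smul_snd, smul_eq_mul] at e1 e2
    simp only [wedge]
    linear_combination v.2 * e1 - v.1 * e2
  have h3 := hball x hx.1
  exact pos_of_mul_pos_left (a := t) (b := wedge u v) (by linarith) huv0.le

end Tangent

/-! ### Area of the region swept by the tangent segments -/

section Area

variable {X : Type*} [NormedAddCommGroup X] [NormedSpace ℝ X] {e : ℝ × ℝ →L[ℝ] X}

/-- The support function of the unit ball on the directions `(1, m)`. -/
noncomputable def slopeSupport (e : ℝ × ℝ →L[ℝ] X) (m : ℝ) : ℝ := wedgeSupport e (1, m)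

/-- The horizontal extent of a segment of slope `m` and length `ε`. -/
noncomputable def slopeLength (e : ℝ × ℝ →L[ℝ] X) (ε m : ℝ) : ℝ := ε / ‖e (1, m)‖

/-- The region swept by the tangent segments of length `ε` pointing to the right. -/
def sweptRegion (e : ℝ × ℝ →L[ℝ] X) (ε : ℝ) : Set (ℝ × ℝ) :=
  tangentPoint (slopeSupport e) '' tangentRegion (slopeSupport e) (slopeLength e ε)

theorem one_slope_ne_zero (m : ℝ) : ((1, m) : ℝ × ℝ) ≠ 0 := by simp

theorem norm_slope_pos (he : Function.Injective e) (m : ℝ) : 0 < ‖e (1, m)‖ := by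
  rw [norm_pos_iff, Ne, map_eq_zero_iff e he]
  exact one_slope_ne_zero m

theorem measurable_slopeLength (e : ℝ × ℝ →L[ℝ] X) (ε : ℝ) : Measurable (slopeLength e ε) := by
  have : Continuous fun m : ℝ => ‖e (1, m)‖ := by fun_prop
  exact this.measurable.const_div ε

theorem exists_lipschitzWith_slopeSupport (he : Function.Injective e) :
    ∃ C : ℝ≥0, LipschitzWith C (slopeSupport e) := by
  obtain ⟨C, hC⟩ := exists_lipschitzWith_wedgeSupport he
  exact ⟨C * 1, hC.comp (LipschitzWith.prodMk_left (1 : ℝ))⟩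

theorem IsTangent.slopeSupport_eq {x : ℝ × ℝ} {m : ℝ} (h : IsTangent e x (1, m)) :
    slopeSupport e m = m * x.1 - x.2 := by
  rw [slopeSupport, h.wedgeSupport_eq, wedge]
  ring

theorem IsTangent.tangentPoint_eq {x : ℝ × ℝ} {m : ℝ} (h : IsTangent e x (1, m)) (t : ℝ) :
    tangentPoint (slopeSupport e) (m, x.1 + t) = x + t • ((1, m) : ℝ × ℝ) := by
  ext
  · simp [tangentPoint]
  · simp only [tangentPoint, h.slopeSupport_eq, Prod.snd_add, Prod.smul_snd, smul_eq_mul]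
    ring

/-- Envelope argument: the affine function of the slope given by `x` lies below the support function
and touches it at `m`. -/
theorem IsTangent.deriv_slopeSupport (he : Function.Injective e) {x : ℝ × ℝ} {m : ℝ}
    (h : IsTangent e x (1, m)) (hm : DifferentiableAt ℝ (slopeSupport e) m) :
    deriv (slopeSupport e) m = x.1 := by
  have hd : HasDerivAt (fun s => slopeSupport e s - (s * x.1 - x.2))
      (deriv (slopeSupport e) m - 1 * x.1) m :=
    hm.hasDerivAt.sub (((hasDerivAt_id m).mul_const x.1).sub_const x.2)
  have hmin : IsLocalMin (fun s => slopeSupport e s - (s * x.1 - x.2)) m := by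
    refine Filter.Eventually.of_forall fun s => ?_
    have h1 := wedge_le_wedgeSupport he h.1 (1, s)
    simp only [wedge] at h1
    change slopeSupport e m - (m * x.1 - x.2) ≤ slopeSupport e s - (s * x.1 - x.2)
    rw [h.slopeSupport_eq, slopeSupport]
    linarith
  linarith [hmin.hasDerivAt_eq_zero hd]

theorem exists_isTangent_of_mem_tangentRegion (he : Function.Injective e) {L : ℝ → ℝ}
    {q : ℝ × ℝ} (hq : q ∈ tangentRegion (slopeSupport e) L) :
    ∃ x t, IsTangent e x (1, q.1) ∧ t ∈ Ioc 0 (L q.1) ∧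
      tangentPoint (slopeSupport e) q = x + t • ((1, q.1) : ℝ × ℝ) := by
  obtain ⟨x, hx⟩ := exists_isTangent he (1, q.1)
  refine ⟨x, q.2 - x.1, hx, ?_, ?_⟩
  · rw [← hx.deriv_slopeSupport he hq.1]; exact hq.2
  · rw [← hx.tangentPoint_eq, add_sub_cancel]

theorem exists_isTangent_of_mem_sweptRegion (he : Function.Injective e) {ε : ℝ}
    {p : ℝ × ℝ} (hp : p ∈ sweptRegion e ε) :
    ∃ x m t, IsTangent e x (1, m) ∧ t ∈ Ioc 0 (slopeLength e ε m) ∧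
      p = x + t • ((1, m) : ℝ × ℝ) := by
  obtain ⟨q, hq, rfl⟩ := hp
  obtain ⟨x, t, hx, ht, hxt⟩ := exists_isTangent_of_mem_tangentRegion he hq
  exact ⟨x, q.1, t, hx, ht, hxt⟩

theorem injOn_tangentPoint_slopeSupport (he : Function.Injective e) (L : ℝ → ℝ) :
    InjOn (tangentPoint (slopeSupport e)) (tangentRegion (slopeSupport e) L) := by
  intro q hq q' hq' heq
  obtain ⟨x, t, hx, ht, hxt⟩ := exists_isTangent_of_mem_tangentRegion he hq
  obtain ⟨x', t', hx', ht', hxt'⟩ := exists_isTangent_of_mem_tangentRegion he hq'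
  have hw := hx.wedge_eq_zero hx' ht.1 ht'.1 (by rw [← hxt, ← hxt', heq])
  simp only [wedge] at hw
  exact Prod.ext (by linarith) (congrArg Prod.fst heq)

theorem measurableSet_sweptRegion (he : Function.Injective e) (ε : ℝ) :
    MeasurableSet (sweptRegion e ε) :=
  measurableSet_image_tangentPoint (measurable_slopeLength e ε)
    (injOn_tangentPoint_slopeSupport he _)

/-- A common point would lie on two tangent half-lines with opposite horizontal directions, hence of
equal slope; the ball lies on opposite sides of these lines. -/
theorem disjoint_sweptRegion_neg (he : Function.Injective e) (ε : ℝ) :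
    Disjoint (sweptRegion e ε) (-sweptRegion e ε) := by
  rw [disjoint_left]
  intro p hp hp'
  obtain ⟨x, m, t, hx, ht, hxt⟩ := exists_isTangent_of_mem_sweptRegion he hp
  obtain ⟨x', m', t', hx', ht', hxt'⟩ := exists_isTangent_of_mem_sweptRegion he
    (Set.mem_neg.1 hp')
  have hpx : p = -x' + t' • -((1, m') : ℝ × ℝ) := by
    rw [smul_neg, ← neg_add, ← hxt', neg_neg]
  have hw := hx.wedge_eq_zero hx'.neg ht.1 ht'.1 (hxt.symm.trans hpx)
  simp only [wedge, Prod.fst_neg, Prod.snd_neg] at hw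
  obtain rfl : m' = m := by linarith
  have h1 := hx.wedge_pos (one_slope_ne_zero _)
  have h2 := hx'.wedge_pos (one_slope_ne_zero _)
  rw [← wedge_add_smul_self _ _ t, ← hxt] at h1
  rw [← wedge_add_smul_self _ _ t', ← hxt'] at h2
  simp only [wedge, Prod.fst_neg, Prod.snd_neg] at h1 h2
  linarith

theorem volume_fst_eq_zero (c : ℝ) : volume {p : ℝ × ℝ | p.1 = c} = 0 := by
  have : {p : ℝ × ℝ | p.1 = c} = {c} ×ˢ univ := by ext; simp
  rw [this, Measure.volume_eq_prod, Measure.prod_prod, Real.volume_singleton, zero_mul]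

theorem volume_setOf_norm_le (e : ℝ × ℝ →L[ℝ] X) {r : ℝ} (hr : 0 < r) :
    volume {v | ‖e v‖ ≤ r} = ENNReal.ofReal (r ^ 2) * volume {v | ‖e v‖ ≤ 1} := by
  have : {v | ‖e v‖ ≤ r} = r • {v | ‖e v‖ ≤ 1} := by
    ext v
    rw [Set.mem_smul_set_iff_inv_smul_mem₀ hr.ne', mem_ofPred_eq, mem_ofPred_eq, map_smul, norm_smul,
      norm_inv, Real.norm_of_nonneg hr.le, inv_mul_le_one₀ hr]
  rw [this, Measure.addHaar_smul, Module.finrank_prod, Module.finrank_self,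
    abs_of_nonneg (by positivity)]

/-- For `k = 0` the lines form the pencil through the origin, so the segments fill the right half of
the ball of radius `ε`. -/
theorem tangentPoint_zero_image (he : Function.Injective e) (ε : ℝ) :
    tangentPoint 0 '' tangentRegion 0 (slopeLength e ε) = {v | ‖e v‖ ≤ ε ∧ 0 < v.1} := by
  have key : ∀ m t : ℝ, 0 < t → (t ≤ slopeLength e ε m ↔ ‖e (t, m * t)‖ ≤ ε) := fun m t ht => by
    have : ((t, m * t) : ℝ × ℝ) = t • ((1, m) : ℝ × ℝ) := by ext <;> simp [mul_comm]
    rw [this, map_smul, norm_smul, Real.norm_of_nonneg ht.le, slopeLength,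
      le_div_iff₀ (norm_slope_pos he m)]
  have hd : ∀ m : ℝ, deriv (0 : ℝ → ℝ) m = 0 := fun m => deriv_const m 0
  ext v
  constructor
  · rintro ⟨q, hq, rfl⟩
    have hq2 := hq.2
    rw [hd, sub_zero] at hq2
    refine ⟨?_, hq2.1⟩
    have := (key q.1 q.2 hq2.1).1 hq2.2
    simpa [tangentPoint] using this
  · rintro ⟨hv, hv0⟩
    have hvv : ((v.1, v.2 / v.1 * v.1) : ℝ × ℝ) = v := by rw [div_mul_cancel₀ _ hv0.ne']
    refine ⟨(v.2 / v.1, v.1), ⟨differentiableAt_const 0, ?_⟩, ?_⟩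
    · change v.1 - deriv 0 (v.2 / v.1) ∈ _
      rw [hd, sub_zero]
      exact ⟨hv0, (key _ _ hv0).2 (by rw [hvv]; exact hv)⟩
    · simpa [tangentPoint] using hvv

theorem injOn_tangentPoint_zero (L : ℝ → ℝ) :
    InjOn (tangentPoint 0) (tangentRegion 0 L) := by
  intro q hq q' _ heq
  have hq2 := hq.2.1
  have hd : deriv (0 : ℝ → ℝ) q.1 = 0 := deriv_const q.1 0
  rw [hd, sub_zero] at hq2
  have h1 : q.2 = q'.2 := congrArg Prod.fst heq
  have h2 : q.1 * q.2 - 0 = q'.1 * q'.2 - 0 := congrArg Prod.snd heq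
  rw [← h1, sub_zero, sub_zero] at h2
  exact Prod.ext (mul_right_cancel₀ hq2.ne' h2) h1

theorem two_mul_volume_half_ball (e : ℝ × ℝ →L[ℝ] X) (r : ℝ) :
    2 * volume {v | ‖e v‖ ≤ r ∧ 0 < v.1} = volume {v | ‖e v‖ ≤ r} := by
  set U := {v | ‖e v‖ ≤ r ∧ 0 < v.1} with hU
  have hUm : MeasurableSet U :=
    (measurableSet_le e.continuous.norm.measurable measurable_const).inter
      (measurableSet_lt measurable_const measurable_fst)
  have hdisj : Disjoint U (-U) := by
    rw [disjoint_left]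
    intro v hv hv'
    have h1 := hv.2
    have h2 := (Set.mem_neg.1 hv').2
    rw [Prod.fst_neg] at h2
    linarith
  have hUU : volume (U ∪ -U) = 2 * volume U := by
    rw [measure_union hdisj hUm.neg, Measure.measure_neg, two_mul]
  rw [← hUU]
  refine le_antisymm (measure_mono ?_) ?_
  · rintro v (hv | hv)
    · exact hv.1
    · simpa using (Set.mem_neg.1 hv).1
  · have : {v | ‖e v‖ ≤ r} ⊆ (U ∪ -U) ∪ {v | v.1 = 0} := by
      intro v hv
      rcases lt_trichotomy v.1 0 with h | h | h
      · exact Or.inl (Or.inr (Set.mem_neg.2 ⟨by simpa using hv, by simpa using h⟩))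
      · exact Or.inr h
      · exact Or.inl (Or.inl ⟨hv, h⟩)
    refine (measure_mono this).trans ((measure_union_le _ _).trans ?_)
    rw [volume_fst_eq_zero, add_zero]

/-- The area swept by all tangent segments of length `ε` is the area of a disc of radius `ε`. -/
theorem volume_sweptRegion_union_neg (he : Function.Injective e) {ε : ℝ} (hε : 0 < ε) :
    volume (sweptRegion e ε ∪ -sweptRegion e ε) =
      ENNReal.ofReal (ε ^ 2) * volume {v | ‖e v‖ ≤ 1} := by
  obtain ⟨C, hC⟩ := exists_lipschitzWith_slopeSupport he
  have hL := measurable_slopeLength e ε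
  rw [measure_union (disjoint_sweptRegion_neg he ε) (measurableSet_sweptRegion he ε).neg,
    Measure.measure_neg, ← two_mul, sweptRegion,
    volume_image_tangentPoint hL hC.ae_differentiableAt_real
      (injOn_tangentPoint_slopeSupport he _),
    -- The same integral, read backwards with `k = 0`, is the area of a half ball.
    ← volume_image_tangentPoint (k := 0) hL
      (Filter.Eventually.of_forall fun _ => differentiableAt_const 0) (injOn_tangentPoint_zero _),
    tangentPoint_zero_image he, two_mul_volume_half_ball, volume_setOf_norm_le e hε]

theorem volume_unitBall_pos (e : ℝ × ℝ →L[ℝ] X) : 0 < volume {v | ‖e v‖ ≤ 1} := by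
  refine lt_of_lt_of_le ?_ (measure_mono (s := {v | ‖e v‖ < 1}) fun v hv =>
    (le_of_lt hv : ‖e v‖ ≤ 1))
  exact (isOpen_lt e.continuous.norm continuous_const).measure_pos volume ⟨0, by simp⟩

/-- Apart from the tangents at which the support function is not differentiable, every point of a
tangent segment of length `ε` pointing to the right belongs to the swept region. -/
theorem mem_sweptRegion_of_isTangent (he : Function.Injective e) {ε : ℝ} {x u : ℝ × ℝ} {t : ℝ}
    (hx : IsTangent e x u) (hu : 0 < u.1) (ht : 0 < t) (htε : t * ‖e u‖ ≤ ε) :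
    x + t • u ∈ sweptRegion e ε ∪ tangentPoint (slopeSupport e) ''
      ({m | ¬ DifferentiableAt ℝ (slopeSupport e) m} ×ˢ univ) := by
  set m := u.2 / u.1 with hm
  have hum : u = u.1 • ((1, m) : ℝ × ℝ) := by
    ext
    · simp
    · simp [hm, mul_div_cancel₀ _ hu.ne']
  have hx' : IsTangent e x (1, m) := by
    have := hx.smul (inv_nonneg.2 hu.le)
    rwa [hum, smul_smul, Prod.smul_fst, smul_eq_mul, mul_one, inv_mul_cancel₀ hu.ne',
      one_smul] at this
  have hp : x + t • u = tangentPoint (slopeSupport e) (m, x.1 + t * u.1) := by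
    rw [hx'.tangentPoint_eq, ← smul_smul, ← hum]
  rw [hp]
  by_cases hd : DifferentiableAt ℝ (slopeSupport e) m
  · refine Or.inl (mem_image_of_mem _ ⟨hd, ?_⟩)
    change x.1 + t * u.1 - deriv (slopeSupport e) m ∈ Ioc 0 (slopeLength e ε m)
    rw [hx'.deriv_slopeSupport he hd, add_sub_cancel_left]
    refine ⟨by positivity, ?_⟩
    rw [slopeLength, le_div_iff₀ (norm_slope_pos he m)]
    rw [hum, map_smul, norm_smul, Real.norm_of_nonneg hu.le, ← mul_assoc] at htε
    simpa using htε
  · exact Or.inr (mem_image_of_mem _ ⟨hd, mem_univ _⟩)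

/-- Vertical tangents have no slope; they lie on two lines, a null set. -/
theorem exists_vertical_isTangent (he : Function.Injective e) : ∃ c : ℝ, ∀ x u : ℝ × ℝ,
    IsTangent e x u → u ≠ 0 → u.1 = 0 → x.1 = c ∨ x.1 = -c := by
  obtain ⟨z, hz⟩ := exists_isTangent he (0, 1)
  refine ⟨z.1, fun x u hx hu hu1 => ?_⟩
  have hu2 : u.2 ≠ 0 := fun h => hu (Prod.ext hu1 h)
  have h1 := hz.2 x hx.1
  have h2 := hz.2 (-x) (by simpa using hx.1)
  have h3 := hx.2 z hz.1
  have h4 := hx.2 (-z) (by simpa using hz.1)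
  simp only [wedge, Prod.fst_neg, Prod.snd_neg, hu1] at h1 h2 h3 h4
  rcases lt_or_gt_of_ne hu2 with h | h
  · right; nlinarith
  · left; nlinarith

/-- Up to a null set, the ball of radius `r` is covered by the unit ball and the tangent segments
of length `ε` when these segments leave the ball. -/
theorem volume_ball_le (he : Function.Injective e) {ε r : ℝ}
    (h : ∀ s ∈ hypotenuseLengths X ε, r < s) (hε : 0 < ε) :
    volume {v | ‖e v‖ ≤ r} ≤ volume {v | ‖e v‖ ≤ 1} +
      volume (sweptRegion e ε ∪ -sweptRegion e ε) := by
  obtain ⟨c, hc⟩ := exists_vertical_isTangent he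
  obtain ⟨C, hC⟩ := exists_lipschitzWith_slopeSupport he
  set W := sweptRegion e ε
  set N := tangentPoint (slopeSupport e) ''
      ({m | ¬ DifferentiableAt ℝ (slopeSupport e) m} ×ˢ univ) with hN
  have hN0 : volume N = 0 :=
    volume_image_tangentPoint_null hC (ae_iff.1 hC.ae_differentiableAt_real)
  have hcover : {v | ‖e v‖ ≤ r} ⊆ ({v | ‖e v‖ ≤ 1} ∪ (W ∪ -W)) ∪
      ((N ∪ -N) ∪ ({p | p.1 = c} ∪ {p | p.1 = -c})) := by
    intro p hp
    by_cases hp1 : ‖e p‖ ≤ 1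
    · exact Or.inl (Or.inl hp1)
    obtain ⟨x, u, t, hu, hx, ht, rfl⟩ := exists_isTangent_add_smul_eq he (not_le.1 hp1)
    have hu0 : 0 < ‖e u‖ := by simpa [map_eq_zero_iff e he] using hu
    -- Beyond length `ε` the norm is at least that of the endpoint, which exceeds `r`.
    have htε : t * ‖e u‖ ≤ ε := by
      by_contra! hlt
      have h1 := h _ (hx.mem_hypotenuseLengths he hu ε)
      have h2 := hx.norm_mono hu (by positivity) ((div_lt_iff₀ hu0).2 hlt).le
      exact absurd (h1.trans_le h2) (not_lt.2 hp)
    rcases lt_trichotomy u.1 0 with hu1 | hu1 | hu1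
    · have hmem := mem_sweptRegion_of_isTangent (ε := ε) he hx.neg (by simpa using hu1) ht
        (by rwa [map_neg, norm_neg])
      rw [smul_neg, ← neg_add] at hmem
      rcases hmem with hmem | hmem
      · exact Or.inl (Or.inr (Or.inr hmem))
      · exact Or.inr (Or.inl (Or.inr hmem))
    · refine Or.inr (Or.inr ?_)
      simpa [hu1] using hc x u hx hu hu1
    · rcases mem_sweptRegion_of_isTangent he hx hu1 ht htε with hmem | hmem
      · exact Or.inl (Or.inr (Or.inl hmem))
      · exact Or.inr (Or.inl (Or.inl hmem))
  have hnull : volume ((N ∪ -N) ∪ ({p : ℝ × ℝ | p.1 = c} ∪ {p | p.1 = -c})) = 0 := by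
    simp only [measure_union_null_iff, Measure.measure_neg, hN0, volume_fst_eq_zero, and_self]
  calc volume {v | ‖e v‖ ≤ r}
      ≤ volume ({v | ‖e v‖ ≤ 1} ∪ (W ∪ -W)) + 0 := by
        rw [← hnull]; exact (measure_mono hcover).trans (measure_union_le _ _)
    _ ≤ _ := by rw [add_zero]; exact measure_union_le _ _

/-- The tangent segments of length `ε` and a smaller concentric ball are disjoint subsets of
every ball that contains the endpoints of these segments. -/
theorem le_volume_ball (he : Function.Injective e) {ε r s : ℝ}
    (h : ∀ l ∈ hypotenuseLengths X ε, l ≤ r) (hs : s < 1) (hr : 1 ≤ r) :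
    volume {v | ‖e v‖ ≤ s} + volume (sweptRegion e ε ∪ -sweptRegion e ε) ≤
      volume {v | ‖e v‖ ≤ r} := by
  have hW : ∀ p ∈ sweptRegion e ε, 1 ≤ ‖e p‖ ∧ ‖e p‖ ≤ r := by
    intro p hp
    obtain ⟨x, m, t, hx, ht, rfl⟩ := exists_isTangent_of_mem_sweptRegion he hp
    have hu := one_slope_ne_zero m
    exact ⟨hx.one_le_norm hu t,
      (hx.norm_mono hu ht.1.le ht.2).trans (h _ (hx.mem_hypotenuseLengths he hu ε))⟩
  have hW' : ∀ p ∈ sweptRegion e ε ∪ -sweptRegion e ε, 1 ≤ ‖e p‖ ∧ ‖e p‖ ≤ r := by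
    rintro p (hp | hp)
    · exact hW p hp
    · simpa using hW _ (Set.mem_neg.1 hp)
  have hm := measurableSet_sweptRegion he ε
  rw [← measure_union _ (hm.union hm.neg)]
  · refine measure_mono (union_subset (fun v hv => ?_) fun p hp => (hW' p hp).2)
    exact (show ‖e v‖ ≤ s from hv).trans (hs.le.trans hr)
  · rw [disjoint_left]
    intro p hp hp'
    have : ‖e p‖ ≤ s := hp
    linarith [(hW' p hp').1]

end Area

/-! ### Comparison of areas and conclusion -/

theorem exists_injective_plane {X : Type*} [NormedAddCommGroup X] [NormedSpace ℝ X]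
    (hX : 2 ≤ Module.rank ℝ X) : ∃ e : ℝ × ℝ →L[ℝ] X, Function.Injective e := by
  have h1 : 1 < Module.rank ℝ X := lt_of_lt_of_le (by norm_num) hX
  have : Nontrivial X := rank_pos_iff_nontrivial.1 (lt_trans (by norm_num) h1)
  obtain ⟨x, hx⟩ := exists_ne (0 : X)
  obtain ⟨y, hxy⟩ := exists_linearIndependent_pair_of_one_lt_rank h1 hx
  refine ⟨(ContinuousLinearMap.fst ℝ ℝ ℝ).smulRight x +
    (ContinuousLinearMap.snd ℝ ℝ ℝ).smulRight y, ?_⟩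
  rw [injective_iff_map_eq_zero]
  intro v hv
  obtain ⟨h2, h3⟩ := LinearIndependent.pair_iff.1 hxy v.1 v.2 (by simpa using hv)
  exact Prod.ext h2 h3

theorem zetaMinus_le_sqrt {X : Type*} [NormedAddCommGroup X] [NormedSpace ℝ X]
    (hX : 2 ≤ Module.rank ℝ X) {ε : ℝ} (hε : 0 < ε) : zetaMinus X ε ≤ Real.sqrt (1 + ε ^ 2) := by
  by_contra! hlt
  obtain ⟨e, he⟩ := exists_injective_plane hX
  obtain ⟨r, hr1, hr2⟩ := exists_between hlt
  have hr0 : 0 < r := (Real.sqrt_nonneg _).trans_lt hr1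
  have hsq : 1 + ε ^ 2 < r ^ 2 := (Real.sqrt_lt' hr0).1 hr1
  have hbdd : BddBelow (hypotenuseLengths X ε) := ⟨0, fun s hs =>
    (hypotenuseLengths_subset X ε hs).1⟩
  have h := volume_ball_le he (fun s hs => hr2.trans_le (csInf_le hbdd hs)) hε
  rw [volume_sweptRegion_union_neg he hε, volume_setOf_norm_le e hr0] at h
  have hA := (volume_unitBall_pos e).ne'
  have hA' := (isCompact_setOf_norm_le he 1).measure_lt_top (μ := volume) |>.ne
  nth_rewrite 2 [← one_mul (volume {v | ‖e v‖ ≤ 1})] at h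
  rw [← add_mul, ENNReal.mul_le_mul_iff_left hA hA', ← ENNReal.ofReal_one,
    ← ENNReal.ofReal_add zero_le_one (by positivity),
    ENNReal.ofReal_le_ofReal_iff (by positivity)] at h
  linarith

theorem sqrt_le_zetaPlus {X : Type*} [NormedAddCommGroup X] [NormedSpace ℝ X]
    (hX : 2 ≤ Module.rank ℝ X) {ε : ℝ} (hε : 0 < ε) : Real.sqrt (1 + ε ^ 2) ≤ zetaPlus X ε := by
  obtain ⟨e, he⟩ := exists_injective_plane hX
  have hbdd : BddAbove (hypotenuseLengths X ε) := ⟨_, fun s hs =>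
    (hypotenuseLengths_subset X ε hs).2⟩
  have hle : ∀ l ∈ hypotenuseLengths X ε, l ≤ zetaPlus X ε := fun l hl => le_csSup hbdd hl
  have hR : 1 ≤ zetaPlus X ε := by
    obtain ⟨x, hx⟩ := exists_isTangent he (1, 0)
    have hu := one_slope_ne_zero 0
    exact (hx.one_le_norm hu _).trans (hle _ (hx.mem_hypotenuseLengths he hu ε))
  refine Real.sqrt_le_iff.2 ⟨by linarith, ?_⟩
  have hA := (volume_unitBall_pos e).ne'
  have hA' := (isCompact_setOf_norm_le he 1).measure_lt_top (μ := volume) |>.ne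
  -- Tangent segments may run along the unit sphere, so disjointness is used for radii `s < 1`, and
  -- then `s` tends to `1`.
  have key : ∀ s ∈ Ioo (0 : ℝ) 1, s ^ 2 + ε ^ 2 ≤ zetaPlus X ε ^ 2 := by
    intro s hs
    have h := le_volume_ball he hle hs.2 hR
    rwa [volume_sweptRegion_union_neg he hε, volume_setOf_norm_le e hs.1,
      volume_setOf_norm_le e (r := zetaPlus X ε) (by linarith), ← add_mul, ENNReal.mul_le_mul_iff_left hA hA',
      ← ENNReal.ofReal_add (by positivity) (by positivity),
      ENNReal.ofReal_le_ofReal_iff (by positivity)] at h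
  have hlim : Filter.Tendsto (fun s : ℝ => s ^ 2 + ε ^ 2) (nhdsWithin 1 (Iio 1))
      (nhds (1 ^ 2 + ε ^ 2)) :=
    (by fun_prop : Continuous fun s : ℝ => s ^ 2 + ε ^ 2).continuousWithinAt
  have := le_of_tendsto hlim (Filter.eventually_of_mem (Ioo_mem_nhdsLT zero_lt_one) key)
  simpa using this

theorem mainTheorem2
    {X : Type*} [NormedAddCommGroup X] [NormedSpace ℝ X] [CompleteSpace X]
    (hX : 2 ≤ Module.rank ℝ X)
    {H : Type*} [NormedAddCommGroup H] [InnerProductSpace ℝ H] [CompleteSpace H]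
    (hH : 2 ≤ Module.rank ℝ H)
    (ε : ℝ) (hε : 0 < ε) :
    zetaMinus X ε ≤ zetaMinus H ε ∧
      zetaMinus H ε = Real.sqrt (1 + ε ^ 2) ∧
      Real.sqrt (1 + ε ^ 2) = zetaPlus H ε ∧
      zetaPlus H ε ≤ zetaPlus X ε := by
  have h1 : zetaMinus H ε = Real.sqrt (1 + ε ^ 2) := by
    rw [zetaMinus, hypotenuseLengths_hilbert hH, csInf_singleton]
  have h2 : zetaPlus H ε = Real.sqrt (1 + ε ^ 2) := by
    rw [zetaPlus, hypotenuseLengths_hilbert hH, csSup_singleton]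
  exact ⟨h1 ▸ zetaMinus_le_sqrt hX hε, h1, h2.symm, h2 ▸ sqrt_le_zetaPlus hX hε⟩
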